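/- **Theorem.** Let $(B_t)_{t\in[0,1]}$ be a Brownian bridge on $[0,1]$, that is, a centred Gaussian process with almost surely continuous paths and covariance $\operatorname{Cov}(B_s,B_t)=\min(s,t)-st$ (a standard Wiener process conditioned on $B_1=0$), and let $\alpha>\tfrac12$. For $f:[0,1]\to\mathbb{R}$, say that $f$ is $\alpha$-Hölder from the right at $x_0\in[0,1)$ if $$\limsup_{y\searrow x_0}\frac{|f(y)-f(x_0)|}{|y-x_0|^{\alpha}}<\infty,$$ and $\alpha$-Hölder from the left at $x_0\in(0,1]$ if the same holds with $y\nearrow x_0$. Then almost surely there is no point $x_0\in[0,1]$ at which the path $t\mapsto B_t$ is $\alpha$-Hölder from the right or from the left. -/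

import Mathlib

open MeasureTheory ProbabilityTheory Filter Topology

noncomputable section

/-- `f : [0,1] → ℝ` is `α`-Hölder at `x₀` from the right:
`limsup_{y ↘ x₀} |f y - f x₀| / |y - x₀| ^ α < ∞`, the `limsup` being taken in the extended reals.
This is meaningful only if `[0,1]` has points to the right of `x₀`. -/
def HolderRightAt (α : ℝ) (f : unitInterval → ℝ) (x₀ : unitInterval) : Prop :=
  x₀ < 1 ∧
    limsup (fun y : unitInterval => ((|f y - f x₀| / |(y : ℝ) - x₀| ^ α : ℝ) : EReal))
      (𝓝[>] x₀) < ⊤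

/-- `f : [0,1] → ℝ` is `α`-Hölder at `x₀` from the left:
`limsup_{y ↗ x₀} |f y - f x₀| / |y - x₀| ^ α < ∞`, the `limsup` being taken in the extended reals.
This is meaningful only if `[0,1]` has points to the left of `x₀`. -/
def HolderLeftAt (α : ℝ) (f : unitInterval → ℝ) (x₀ : unitInterval) : Prop :=
  0 < x₀ ∧
    limsup (fun y : unitInterval => ((|f y - f x₀| / |(y : ℝ) - x₀| ^ α : ℝ) : EReal))
      (𝓝[<] x₀) < ⊤

/-- A (standard) Brownian bridge on `[0,1]`: a centred Gaussian process with almost surely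
continuous paths and covariance function `min s t - s t`, that is, the Wiener process on `[0,1]`
conditioned to vanish at time `1`. -/
structure IsBrownianBridge {Ω : Type*} [MeasurableSpace Ω]
    (B : unitInterval → Ω → ℝ) (P : Measure Ω) : Prop where
  isGaussianProcess : IsGaussianProcess B P
  integral_eq_zero : ∀ t, ∫ ω, B t ω ∂P = 0
  covariance_eq : ∀ s t : unitInterval, covariance (B s) (B t) P = min (s : ℝ) t - s * t
  continuous_paths : ∀ᵐ ω ∂P, Continuous fun t => B t ω

end

/-! A right-sided Hölder bound of exponent `β > 1/2` at a single point forces `m` consecutive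
increments over every sufficiently fine grid of mesh `1/n` to be `O(n^(-β))`. Increments have
standard deviation of order `n^(-1/2)`, so if they were independent a given run would be this small
with probability `O(n^(-m(β - 1/2)))`. Summing over at most `n` starting positions leaves `O(n^(1 -
m(β - 1/2)))`, which vanishes as soon as `m(β - 1/2) > 1`.

Bridge increments are dependent, but their covariance matrix is `(1/n) I - (1/n²) J`, with `J` all
ones. Adding `Z/n` to each, with `Z` an independent standard normal, makes them independent. On `|Z|
≤ 1` this widens the bounds only by `1/n`, and conditioning on that event costs a constant factor
(`measure_forall_abs_le_mul_le`). Left-sided bounds follow by time reversal. -/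

/-! ### Gaussian small-ball estimates -/

/-- The centred Gaussian law gives a symmetric interval mass at most its length over the standard
deviation. -/
lemma gaussianReal_Icc_neg_self_le {v : NNReal} (hv : v ≠ 0) (r : ℝ) :
    gaussianReal 0 v (Set.Icc (-r) r) ≤ ENNReal.ofReal (2 * r / √v) := by
  have hv' : (0 : ℝ) < v := by positivity
  rw [gaussianReal_apply 0 hv]
  have hpdf : ∀ x, gaussianPDF 0 v x ≤ ENNReal.ofReal (1 / √v) := by
    intro x
    rw [gaussianPDF, gaussianPDFReal_def]
    apply ENNReal.ofReal_le_ofReal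
    have h1 : Real.exp (-(x - 0) ^ 2 / (2 * v)) ≤ 1 := by
      rw [Real.exp_le_one_iff]
      exact div_nonpos_of_nonpos_of_nonneg (by simpa using sq_nonneg x) (by positivity)
    have h2 : (√(2 * Real.pi * v))⁻¹ ≤ 1 / √(v : ℝ) := by
      rw [one_div]
      apply inv_anti₀ (by positivity)
      apply Real.sqrt_le_sqrt
      nlinarith [Real.pi_gt_three]
    calc _ ≤ (√(2 * Real.pi * v))⁻¹ * 1 := mul_le_mul_of_nonneg_left h1 (by positivity)
      _ ≤ _ := by simpa using h2
  calc ∫⁻ x in Set.Icc (-r) r, gaussianPDF 0 v x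
      ≤ ∫⁻ _ in Set.Icc (-r) r, ENNReal.ofReal (1 / √v) := lintegral_mono hpdf
    _ = ENNReal.ofReal (1 / √v) * ENNReal.ofReal (r - -r) := by simp
    _ = ENNReal.ofReal (2 * r / √v) := by
        rw [← ENNReal.ofReal_mul (by positivity)]
        congr 1
        ring

/-- Small ball estimate for a centred Gaussian vector whose covariance matrix is `a • 1 - b ^ 2 • J`
with `J` the all-ones matrix: adding `b` times an independent standard Gaussian variable to every
coordinate makes the coordinates independent. -/
lemma measure_forall_abs_le_mul_le {Ω : Type*} [MeasurableSpace Ω] {P : Measure Ω} {m : ℕ}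
    {X : Fin m → Ω → ℝ} (hX : HasGaussianLaw (fun ω i => X i ω) P)
    (hmean : ∀ i, ∫ ω, X i ω ∂P = 0) {a b : ℝ} (ha : 0 < a) (hb : 0 ≤ b)
    (hcov : ∀ i j, cov[X i, X j; P] = (if i = j then a else 0) - b ^ 2) (r : ℝ) :
    P {ω | ∀ i, |X i ω| ≤ r} * gaussianReal 0 1 (Set.Icc (-1) 1) ≤
      ENNReal.ofReal (2 * (r + b) / √a) ^ m := by
  have := hX.isProbabilityMeasure
  set γ := gaussianReal 0 1 with hγ
  set Q := P.prod γ with hQ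
  have hXi : ∀ i, HasGaussianLaw (X i) P := hX.eval
  have hfst : MeasurePreserving Prod.fst Q P := measurePreserving_fst
  have hsnd : MeasurePreserving Prod.snd Q γ := measurePreserving_snd
  have hX' : HasGaussianLaw (fun p : Ω × ℝ => fun i => X i p.1) Q := by
    constructor
    have := hX.isGaussian_map
    rw [← hfst.map_eq, AEMeasurable.map_map_of_aemeasurable
      (by rw [hfst.map_eq]; exact hX.aemeasurable) (by fun_prop)] at this
    exact this
  have hZ : HasGaussianLaw (fun p : Ω × ℝ => p.2) Q := by
    constructor
    rw [show (fun p : Ω × ℝ => p.2) = Prod.snd from rfl, hsnd.map_eq]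
    infer_instance
  have hind : IndepFun (fun p : Ω × ℝ => fun i => X i p.1) (fun p : Ω × ℝ => p.2) Q :=
    indepFun_prod₀ (Y := fun z : ℝ => z) hX.aemeasurable aemeasurable_id
  have hXZ := hind.hasGaussianLaw hX' hZ
  -- The perturbed vector is a linear image of a Gaussian vector, hence jointly Gaussian; this is
  -- what lets vanishing covariances give independence.
  let L : ((Fin m → ℝ) × ℝ) →L[ℝ] (Fin m → ℝ) :=
    ContinuousLinearMap.pi fun i =>
      (ContinuousLinearMap.proj i).comp (ContinuousLinearMap.fst ℝ (Fin m → ℝ) ℝ) +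
        b • ContinuousLinearMap.snd ℝ (Fin m → ℝ) ℝ
  let Y : Fin m → Ω × ℝ → ℝ := fun i p => X i p.1 + b * p.2
  have hY : HasGaussianLaw (fun p i => Y i p) Q := hXZ.map L
  have hYi : ∀ i, HasGaussianLaw (Y i) Q := hY.eval
  have hX2 : ∀ i, MemLp (fun p : Ω × ℝ => X i p.1) 2 Q := fun i => (hX'.eval i).memLp_two
  have hbZ : HasGaussianLaw (fun p : Ω × ℝ => b * p.2) Q := hZ.fun_smul b
  have hbZ2 := hbZ.memLp_two
  have hcovX : ∀ i j, cov[fun p : Ω × ℝ => X i p.1, fun p => X j p.1; Q] =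
      (if i = j then a else 0) - b ^ 2 := by
    intro i j
    rw [← hcov i j, ← hfst.map_eq]
    rw [covariance_map (by rw [hfst.map_eq]; exact (hXi i).aemeasurable.aestronglyMeasurable)
      (by rw [hfst.map_eq]; exact (hXi j).aemeasurable.aestronglyMeasurable) (by fun_prop)]
    rfl
  have hcovXZ : ∀ i, cov[fun p : Ω × ℝ => X i p.1, fun p : Ω × ℝ => b * p.2; Q] = 0 := by
    intro i
    rw [covariance_const_mul_right,
      covariance_fst_snd_prod (Y := fun z : ℝ => z) (hXi i).memLp_two
        (memLp_id_gaussianReal' 2 (by simp)), mul_zero]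
  have hvarZ : cov[fun p : Ω × ℝ => b * p.2, fun p : Ω × ℝ => b * p.2; Q] = b ^ 2 := by
    have h1 : Var[fun p : Ω × ℝ => p.2; Q] = 1 := by
      have := variance_map (μ := Q) (X := fun z : ℝ => z) (Y := Prod.snd) (by fun_prop)
        (by fun_prop)
      rw [hsnd.map_eq, hγ, variance_fun_id_gaussianReal] at this
      simpa [Function.comp_def] using this.symm
    rw [covariance_const_mul_right, covariance_const_mul_left, covariance_self (by fun_prop), h1]
    ring
  have hcovY : ∀ i j, cov[Y i, Y j; Q] = if i = j then a else 0 := by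
    intro i j
    have e : ∀ i, Y i = (fun p : Ω × ℝ => X i p.1) + fun p : Ω × ℝ => b * p.2 := fun i => rfl
    rw [e i, e j, covariance_add_left (hX2 i) hbZ2 ((hX2 j).add hbZ2),
      covariance_add_right (hX2 i) (hX2 j) hbZ2, covariance_add_right hbZ2 (hX2 j) hbZ2,
      hcovX, hcovXZ, covariance_comm, hcovXZ, hvarZ]
    ring
  have hYind : iIndepFun Y Q :=
    hY.iIndepFun_of_covariance_eq_zero fun i j hij => by simp [hcovY, hij]
  have hmeanY : ∀ i, ∫ p, Y i p ∂Q = 0 := by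
    intro i
    have hZ0 : ∫ p : Ω × ℝ, p.2 ∂Q = 0 := by
      have := integral_map (μ := Q) (φ := Prod.snd) (by fun_prop)
        (f := fun z : ℝ => z) (by fun_prop)
      rw [← this, hsnd.map_eq, hγ, integral_id_gaussianReal]
    have hX0 : ∫ p : Ω × ℝ, X i p.1 ∂Q = 0 := by
      have := integral_map (μ := Q) (φ := Prod.fst) (by fun_prop)
        (f := X i) (by rw [hfst.map_eq]; exact (hXi i).aemeasurable.aestronglyMeasurable)
      rw [← this, hfst.map_eq, hmean]
    rw [integral_add (hX'.eval i).integrable hbZ.integrable, hX0, integral_const_mul, hZ0]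
    simp
  have hlaw : ∀ i, Q.map (Y i) = gaussianReal 0 a.toNNReal := by
    intro i
    rw [(hYi i).map_eq_gaussianReal, hmeanY, ← covariance_self (hYi i).aemeasurable, hcovY]
    simp
  have hball : ∀ i, Q (Y i ⁻¹' Set.Icc (-(r + b)) (r + b)) ≤
      ENNReal.ofReal (2 * (r + b) / √a) := by
    intro i
    rw [← Measure.map_apply_of_aemeasurable (hYi i).aemeasurable measurableSet_Icc, hlaw]
    have := gaussianReal_Icc_neg_self_le (v := a.toNNReal) (by simpa using ha) (r + b)
    rwa [Real.coe_toNNReal _ ha.le] at this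
  calc P {ω | ∀ i, |X i ω| ≤ r} * γ (Set.Icc (-1) 1)
      = Q ({ω | ∀ i, |X i ω| ≤ r} ×ˢ Set.Icc (-1) 1) := (Measure.prod_prod _ _).symm
    _ ≤ Q (⋂ i, Y i ⁻¹' Set.Icc (-(r + b)) (r + b)) := by
        apply measure_mono
        rintro ⟨ω, z⟩ ⟨h1, h2⟩
        simp only [Set.mem_iInter, Set.mem_preimage]
        intro i
        have h3 := abs_le.1 (h1 i)
        constructor
        · have : -b ≤ b * z := by nlinarith [h2.1]
          change _ ≤ X i ω + b * z
          linarith [h3.1]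
        · have : b * z ≤ b := by nlinarith [h2.2]
          change X i ω + b * z ≤ _
          linarith [h3.2]
    _ = ∏ i, Q (Y i ⁻¹' Set.Icc (-(r + b)) (r + b)) :=
        hYind.meas_iInter fun i => ⟨_, measurableSet_Icc, rfl⟩
    _ ≤ ∏ _i : Fin m, ENNReal.ofReal (2 * (r + b) / √a) :=
        Finset.prod_le_prod' fun i _ => hball i
    _ = _ := by simp

/-! ### Bridge increments over a uniform grid -/

/-- The point `j / n` of the unit interval, truncated at `1`. -/
noncomputable def gridPoint (n j : ℕ) : unitInterval := Set.projIcc 0 1 zero_le_one ((j : ℝ) / n)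

lemma coe_gridPoint {n j : ℕ} (h : j ≤ n) : (gridPoint n j : ℝ) = j / n := by
  have hmem : (j : ℝ) / n ∈ Set.Icc (0 : ℝ) 1 :=
    ⟨by positivity, div_le_one_of_le₀ (by exact_mod_cast h) (by positivity)⟩
  rw [gridPoint, Set.projIcc_of_mem _ hmem]

namespace IsBrownianBridge

variable {Ω : Type*} [MeasurableSpace Ω] {P : Measure Ω} {B : unitInterval → Ω → ℝ}

/-- The time reversal of a Brownian bridge is a Brownian bridge. -/
lemma comp_symm (hB : IsBrownianBridge B P) :
    IsBrownianBridge (fun t => B (unitInterval.symm t)) P where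
  isGaussianProcess := hB.isGaussianProcess.comp_right unitInterval.symm
  integral_eq_zero t := hB.integral_eq_zero _
  covariance_eq s t := by
    rw [hB.covariance_eq, unitInterval.coe_symm_eq, unitInterval.coe_symm_eq]
    rcases le_total (s : ℝ) t with h | h
    · rw [min_eq_right (by linarith), min_eq_left h]; ring
    · rw [min_eq_left (by linarith), min_eq_right h]; ring
  continuous_paths := hB.continuous_paths.mono fun _ h => h.comp unitInterval.continuous_symm

/-- The `min s t` part gives the Wiener covariance `1/n` on the diagonal; the `-s t` part is a
product, so it contributes `-(1/n)²` to every entry. -/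
lemma covariance_increments (hB : IsBrownianBridge B P) {n i j : ℕ} (hn : 0 < n)
    (hi : i < n) (hj : j < n) :
    cov[B (gridPoint n (i + 1)) - B (gridPoint n i),
      B (gridPoint n (j + 1)) - B (gridPoint n j); P] =
      (if i = j then 1 / (n : ℝ) else 0) - (1 / n) ^ 2 := by
  have := hB.isGaussianProcess.isProbabilityMeasure
  have h2 : ∀ t, MemLp (B t) 2 P := fun t => (hB.isGaussianProcess.hasGaussianLaw_eval t).memLp_two
  rw [covariance_sub_left (h2 _) (h2 _) ((h2 _).sub (h2 _)),
    covariance_sub_right (h2 _) (h2 _) (h2 _), covariance_sub_right (h2 _) (h2 _) (h2 _)]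
  simp only [hB.covariance_eq]
  rw [coe_gridPoint hi, coe_gridPoint hi.le, coe_gridPoint hj, coe_gridPoint hj.le]
  have hn' : (0 : ℝ) < n := by exact_mod_cast hn
  simp only [min_div_div_right hn'.le, ← Nat.cast_min]
  rcases lt_trichotomy i j with h | h | h
  · rw [min_eq_left (by omega : i + 1 ≤ j + 1), min_eq_left (by omega : i + 1 ≤ j),
      min_eq_left (by omega : i ≤ j + 1), min_eq_left h.le, if_neg h.ne]
    push_cast
    field_simp
    ring
  · subst h
    rw [min_self, min_self, min_eq_right (by omega : i ≤ i + 1), min_eq_left (by omega : i ≤ i + 1),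
      if_pos rfl]
    push_cast
    field_simp
    ring
  · rw [min_eq_right (by omega : j + 1 ≤ i + 1), min_eq_right (by omega : j ≤ i + 1),
      min_eq_right (by omega : j + 1 ≤ i), min_eq_right h.le, if_neg h.ne']
    push_cast
    field_simp
    ring

/-- The probability that `m` consecutive increments over a grid of mesh `1 / n` are small. -/
lemma measure_increments_le (hB : IsBrownianBridge B P) {n m k : ℕ} (hn : 0 < n)
    (hk : k + m ≤ n) (r : ℝ) :
    P {ω | ∀ i < m, |B (gridPoint n (k + i + 1)) ω - B (gridPoint n (k + i)) ω| ≤ r} *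
        gaussianReal 0 1 (Set.Icc (-1) 1) ≤
      ENNReal.ofReal (2 * (r + 1 / n) / √(1 / n)) ^ m := by
  have hn' : (0 : ℝ) < n := by exact_mod_cast hn
  have key := measure_forall_abs_le_mul_le
    (X := fun i : Fin m => B (gridPoint n (k + i + 1)) - B (gridPoint n (k + i)))
    (hB.isGaussianProcess.hasGaussianLaw_increments
      (t := fun j : Fin (m + 1) => gridPoint n (k + j)))
    (fun i => by
      have h := fun t => (hB.isGaussianProcess.hasGaussianLaw_eval t).integrable
      simp [integral_sub (h _) (h _), hB.integral_eq_zero])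
    (a := 1 / n) (b := 1 / n) (by positivity) (by positivity)
    (fun i j => by
      rw [hB.covariance_increments hn (by omega) (by omega)]
      simp [Fin.ext_iff]) r
  refine le_trans ?_ key
  gcongr
  exact fun h i => h i i.2

end IsBrownianBridge

/-! ### From Hölder points to small increments -/

/-- A one-sided Hölder bound at `x₀` forces `m` consecutive increments over every fine grid to be
small. -/
lemma eventually_exists_small_increments {f : unitInterval → ℝ} {x₀ : unitInterval} (hx₀ : x₀ < 1)
    {β C δ : ℝ} (hβ : 0 ≤ β) (hC : 0 ≤ C) (hδ : 0 < δ)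
    (hf : ∀ y : unitInterval, x₀ < y → (y : ℝ) - x₀ < δ → |f y - f x₀| ≤ C * ((y : ℝ) - x₀) ^ β)
    (m : ℕ) :
    ∀ᶠ n : ℕ in atTop, ∃ k, k + m ≤ n ∧ ∀ i < m,
      |f (gridPoint n (k + i + 1)) - f (gridPoint n (k + i))| ≤
        2 * C * (m + 1) ^ β * (n : ℝ) ^ (-β) := by
  have hx1 : (x₀ : ℝ) < 1 := hx₀
  have hlim : Tendsto (fun n : ℕ => ((m : ℝ) + 1) / n) atTop (𝓝 0) :=
    tendsto_const_div_atTop_nhds_zero_nat _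
  filter_upwards [eventually_gt_atTop 0, hlim.eventually (gt_mem_nhds hδ),
    hlim.eventually (gt_mem_nhds (sub_pos.2 hx1))] with n hn hnδ hn1
  have hn' : (0 : ℝ) < n := by exact_mod_cast hn
  have hfl := Nat.floor_le (mul_nonneg hn'.le x₀.2.1)
  have hfl' := Nat.lt_floor_add_one ((n : ℝ) * x₀)
  rw [div_lt_iff₀ hn'] at hn1
  have hkm : ⌊(n : ℝ) * x₀⌋₊ + 1 + m ≤ n := by
    have : ((⌊(n : ℝ) * x₀⌋₊ + 1 + m : ℕ) : ℝ) ≤ n := by push_cast; linarith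
    exact_mod_cast this
  -- The index `⌊n x₀⌋ + 1` is the first grid index strictly to the right of `x₀`, so the `m + 1`
  -- endpoints of the run lie within `(m + 1)/n` of `x₀`. Comparing neighbours through `f x₀` then
  -- produces the factor `2`.
  have hbound : ∀ i ≤ m, |f (gridPoint n (⌊(n : ℝ) * x₀⌋₊ + 1 + i)) - f x₀| ≤
      C * (((m : ℝ) + 1) / n) ^ β := by
    intro i hi
    have hval := coe_gridPoint (n := n) (j := ⌊(n : ℝ) * x₀⌋₊ + 1 + i) (by omega)
    have hi' : (i : ℝ) ≤ m := by exact_mod_cast hi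
    have hgt : (x₀ : ℝ) < gridPoint n (⌊(n : ℝ) * x₀⌋₊ + 1 + i) := by
      rw [hval, lt_div_iff₀ hn']
      push_cast
      linarith [(Nat.cast_nonneg i : (0 : ℝ) ≤ i)]
    have hle : (gridPoint n (⌊(n : ℝ) * x₀⌋₊ + 1 + i) : ℝ) - x₀ ≤ ((m : ℝ) + 1) / n := by
      rw [hval, sub_le_iff_le_add, div_add' _ _ _ hn'.ne']
      gcongr
      push_cast
      linarith
    refine (hf _ hgt (hle.trans_lt hnδ)).trans ?_
    gcongr
  refine ⟨⌊(n : ℝ) * x₀⌋₊ + 1, hkm, fun i hi => ?_⟩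
  have h1 := hbound i hi.le
  have h2 := hbound (i + 1) hi
  have e : (((m : ℝ) + 1) / n) ^ β = (m + 1) ^ β * (n : ℝ) ^ (-β) := by
    rw [Real.div_rpow (by positivity) hn'.le, Real.rpow_neg hn'.le, div_eq_mul_inv]
  rw [e] at h1 h2
  rw [← add_assoc] at h2
  rw [abs_le] at *
  constructor <;> linarith [h1.1, h1.2, h2.1, h2.2]

/-- An extended-real `limsup` of difference quotients that is finite bounds the increments, with
any smaller exponent. -/
lemma exists_eventually_abs_sub_le {α β : ℝ} {f : unitInterval → ℝ} {x₀ : unitInterval}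
    (hβ : β ≤ α) {l : Filter unitInterval} (hne : ∀ᶠ y in l, y ≠ x₀)
    (h : limsup (fun y : unitInterval => ((|f y - f x₀| / |(y : ℝ) - x₀| ^ α : ℝ) : EReal)) l < ⊤) :
    ∃ C : ℝ, 0 ≤ C ∧ ∀ᶠ y : unitInterval in l, |f y - f x₀| ≤ C * |(y : ℝ) - x₀| ^ β := by
  obtain ⟨c, hc, -⟩ := EReal.lt_iff_exists_real_btwn.1 h
  refine ⟨max c 0, le_max_right _ _, ?_⟩
  filter_upwards [eventually_lt_of_limsup_lt hc, hne] with y hy hyx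
  have hpos : 0 < |(y : ℝ) - x₀| := abs_pos.2 (sub_ne_zero.2 fun e => hyx (Subtype.ext e))
  have hle : |(y : ℝ) - x₀| ≤ 1 :=
    abs_le.2 ⟨by linarith [y.2.1, x₀.2.2], by linarith [y.2.2, x₀.2.1]⟩
  have hy' := EReal.coe_lt_coe_iff.1 hy
  rw [div_lt_iff₀ (by positivity)] at hy'
  calc |f y - f x₀| ≤ c * |(y : ℝ) - x₀| ^ α := hy'.le
    _ ≤ max c 0 * |(y : ℝ) - x₀| ^ α := by gcongr; exact le_max_left _ _
    _ ≤ max c 0 * |(y : ℝ) - x₀| ^ β := by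
        gcongr max c 0 * ?_
        exact Real.rpow_le_rpow_of_exponent_ge hpos hle hβ

lemma HolderRightAt.exists_bound {α β : ℝ} {f : unitInterval → ℝ} {x₀ : unitInterval}
    (hβ : β ≤ α) (h : HolderRightAt α f x₀) :
    ∃ C δ : ℝ, 0 ≤ C ∧ 0 < δ ∧ ∀ y : unitInterval, x₀ < y → (y : ℝ) - x₀ < δ →
      |f y - f x₀| ≤ C * ((y : ℝ) - x₀) ^ β := by
  obtain ⟨C, hC, hev⟩ := exists_eventually_abs_sub_le hβ
    (eventually_mem_nhdsWithin.mono fun y (hy : x₀ < y) => hy.ne') h.2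
  obtain ⟨δ, hδ, hball⟩ := Metric.mem_nhdsWithin_iff.1 hev
  refine ⟨C, δ, hC, hδ, fun y hy hyδ => ?_⟩
  have hy' : (x₀ : ℝ) < y := hy
  have := hball ⟨(by rw [Metric.mem_ball, Subtype.dist_eq, Real.dist_eq,
    abs_of_pos (sub_pos.2 hy')]; exact hyδ), hy⟩
  simpa [abs_of_pos (sub_pos.2 hy')] using this

lemma HolderLeftAt.exists_bound {α β : ℝ} {f : unitInterval → ℝ} {x₀ : unitInterval}
    (hβ : β ≤ α) (h : HolderLeftAt α f x₀) :
    ∃ C δ : ℝ, 0 ≤ C ∧ 0 < δ ∧ ∀ y : unitInterval, y < x₀ → (x₀ : ℝ) - y < δ →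
      |f y - f x₀| ≤ C * ((x₀ : ℝ) - y) ^ β := by
  obtain ⟨C, hC, hev⟩ := exists_eventually_abs_sub_le hβ
    (eventually_mem_nhdsWithin.mono fun y (hy : y < x₀) => hy.ne) h.2
  obtain ⟨δ, hδ, hball⟩ := Metric.mem_nhdsWithin_iff.1 hev
  refine ⟨C, δ, hC, hδ, fun y hy hyδ => ?_⟩
  have hy' : (y : ℝ) < x₀ := hy
  have := hball ⟨(by rw [Metric.mem_ball, Subtype.dist_eq, Real.dist_eq, abs_sub_comm,
    abs_of_pos (sub_pos.2 hy')]; exact hyδ), hy⟩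
  simpa [abs_sub_comm (y : ℝ), abs_of_pos (sub_pos.2 hy')] using this

/-! ### Union bound and almost sure exclusion -/

namespace IsBrownianBridge

variable {Ω : Type*} [MeasurableSpace Ω] {P : Measure Ω} {B : unitInterval → Ω → ℝ}

lemma tendsto_measure_exists_small_increments (hB : IsBrownianBridge B P) {β D : ℝ} (hβ1 : β ≤ 1)
    (hD : 0 ≤ D) {m : ℕ} (hm : 1 < m * (β - 1 / 2)) :
    Tendsto (fun n : ℕ => P {ω | ∃ k, k + m ≤ n ∧ ∀ i < m,
      |B (gridPoint n (k + i + 1)) ω - B (gridPoint n (k + i)) ω| ≤ D * (n : ℝ) ^ (-β)})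
      atTop (𝓝 0) := by
  set p := gaussianReal 0 1 (Set.Icc (-1) 1) with hp
  have hp0 : p ≠ 0 := fun h => by
    have := gaussianReal_absolutelyContinuous' 0 one_ne_zero h
    norm_num at this
  have hptop : p ≠ ⊤ := measure_ne_top _ _
  have hm0 : m ≠ 0 := by rintro rfl; norm_num at hm
  have hlim : Tendsto (fun n : ℕ => p⁻¹ * ENNReal.ofReal
      ((2 * (D + 1)) ^ m * (n : ℝ) ^ (-(m * (β - 1 / 2) - 1)))) atTop (𝓝 0) := by
    have h1 := ((tendsto_rpow_neg_atTop (sub_pos.2 hm)).comp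
      tendsto_natCast_atTop_atTop).const_mul ((2 * (D + 1)) ^ m)
    have h2 := ENNReal.Tendsto.const_mul (a := p⁻¹) (ENNReal.tendsto_ofReal h1)
      (Or.inr (by simpa using hp0))
    simpa using h2
  refine tendsto_of_tendsto_of_tendsto_of_le_of_le' tendsto_const_nhds hlim
    (Eventually.of_forall fun _ => zero_le) ?_
  filter_upwards [eventually_gt_atTop 0] with n hn
  have hn' : (0 : ℝ) < n := by exact_mod_cast hn
  have hn1 : (1 : ℝ) ≤ n := by exact_mod_cast hn
  have hratio : 2 * (D * (n : ℝ) ^ (-β) + 1 / n) / √(1 / n) ≤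
      2 * (D + 1) * (n : ℝ) ^ (-(β - 1 / 2)) := by
    -- This is where `β ≤ 1` enters: the widening `1/n` is absorbed into the increment bound,
    -- turning `D` into `D + 1`.
    have h1 : 1 / (n : ℝ) ≤ (n : ℝ) ^ (-β) := by
      rw [one_div, ← Real.rpow_neg_one]
      exact Real.rpow_le_rpow_of_exponent_le hn1 (by linarith)
    have h2 : √(1 / (n : ℝ)) = (n : ℝ) ^ (-(1 / 2) : ℝ) := by
      rw [Real.sqrt_eq_rpow, one_div, Real.inv_rpow hn'.le, Real.rpow_neg hn'.le]
    rw [h2, div_le_iff₀ (by positivity), mul_assoc, ← Real.rpow_add hn']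
    rw [show -(β - 1 / 2) + -(1 / 2) = -β by ring]
    linarith
  calc P {ω | ∃ k, k + m ≤ n ∧ ∀ i < m,
        |B (gridPoint n (k + i + 1)) ω - B (gridPoint n (k + i)) ω| ≤ D * (n : ℝ) ^ (-β)}
      ≤ P (⋃ k ∈ (Finset.range n).filter (fun k => k + m ≤ n), {ω | ∀ i < m,
        |B (gridPoint n (k + i + 1)) ω - B (gridPoint n (k + i)) ω| ≤ D * (n : ℝ) ^ (-β)}) := by
        apply measure_mono
        rintro ω ⟨k, hk, h⟩
        simp only [Set.mem_iUnion, Finset.mem_filter, Finset.mem_range]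
        -- `k < n` because `m ≠ 0`.
        exact ⟨k, ⟨by omega, hk⟩, h⟩
    _ ≤ ∑ k ∈ (Finset.range n).filter (fun k => k + m ≤ n), P {ω | ∀ i < m,
        |B (gridPoint n (k + i + 1)) ω - B (gridPoint n (k + i)) ω| ≤ D * (n : ℝ) ^ (-β)} :=
        measure_biUnion_finset_le _ _
    _ ≤ ∑ k ∈ (Finset.range n).filter (fun k => k + m ≤ n),
        p⁻¹ * ENNReal.ofReal (2 * (D + 1) * (n : ℝ) ^ (-(β - 1 / 2))) ^ m := by
        refine Finset.sum_le_sum fun k hk => ?_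
        have := hB.measure_increments_le hn (Finset.mem_filter.1 hk).2 (D * (n : ℝ) ^ (-β))
        rw [mul_comm p⁻¹, ← div_eq_mul_inv, ENNReal.le_div_iff_mul_le (.inl hp0) (.inl hptop)]
        exact this.trans (by gcongr)
    _ ≤ n * (p⁻¹ * ENNReal.ofReal (2 * (D + 1) * (n : ℝ) ^ (-(β - 1 / 2))) ^ m) := by
        rw [Finset.sum_const, nsmul_eq_mul]
        gcongr
        exact (Finset.card_filter_le _ _).trans (by simp)
    _ = p⁻¹ * ENNReal.ofReal ((2 * (D + 1)) ^ m * (n : ℝ) ^ (-(m * (β - 1 / 2) - 1))) := by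
        rw [← ENNReal.ofReal_pow (by positivity), mul_left_comm, ← ENNReal.ofReal_natCast,
          ← ENNReal.ofReal_mul (by positivity)]
        congr 2
        rw [mul_pow, ← Real.rpow_mul_natCast hn'.le,
          show -(m * (β - 1 / 2) - 1) = -(β - 1 / 2) * m + 1 by ring, Real.rpow_add hn',
          Real.rpow_one]
        ring

/-- Almost surely no point admits a right-sided Hölder bound of exponent `β > 1 / 2`. -/
lemma ae_not_exists_bound (hB : IsBrownianBridge B P) {β : ℝ} (hβ : 1 / 2 < β) (hβ1 : β ≤ 1) :
    ∀ᵐ ω ∂P, ¬ ∃ x₀ : unitInterval, x₀ < 1 ∧ ∃ C δ : ℝ, 0 ≤ C ∧ 0 < δ ∧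
      ∀ y : unitInterval, x₀ < y → (y : ℝ) - x₀ < δ →
        |B y ω - B x₀ ω| ≤ C * ((y : ℝ) - x₀) ^ β := by
  obtain ⟨m, hm⟩ := exists_nat_gt (1 / (β - 1 / 2))
  rw [div_lt_iff₀ (by linarith)] at hm
  let E : ℕ → ℕ → Set Ω := fun D n => {ω | ∃ k, k + m ≤ n ∧ ∀ i < m,
      |B (gridPoint n (k + i + 1)) ω - B (gridPoint n (k + i)) ω| ≤ D * (n : ℝ) ^ (-β)}
  -- Natural constants `D` and thresholds `N` make the union countable. Each intersection is
  -- contained in every `E D n` with `n ≥ N`, so convergence of the measures to `0` suffices, with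
  -- no summability. The uncountable choice of `x₀` has already been absorbed into the grid position
  -- `k`.
  have hnull : P (⋃ D : ℕ, ⋃ N : ℕ, ⋂ n ≥ N, E D n) = 0 := by
    refine measure_iUnion_null fun D => measure_iUnion_null fun N => le_antisymm ?_ zero_le
    refine ge_of_tendsto (hB.tendsto_measure_exists_small_increments hβ1 D.cast_nonneg hm) ?_
    filter_upwards [eventually_ge_atTop N] with n hn
    exact measure_mono (Set.iInter₂_subset n hn)
  rw [ae_iff]
  refine measure_mono_null ?_ hnull
  intro ω hω
  simp only [not_not, Set.mem_ofPred_eq] at hω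
  obtain ⟨x₀, hx₀, C, δ, hC, hδ, hf⟩ := hω
  obtain ⟨D, hD⟩ := exists_nat_ge (2 * C * ((m : ℝ) + 1) ^ β)
  obtain ⟨N, hN⟩ := eventually_atTop.1 (eventually_exists_small_increments
    (f := fun t => B t ω) hx₀ (by linarith) hC hδ hf m)
  simp only [Set.mem_iUnion, Set.mem_iInter]
  refine ⟨D, N, fun n hn => ?_⟩
  obtain ⟨k, hk, h⟩ := hN n hn
  exact ⟨k, hk, fun i hi => (h i hi).trans (by gcongr)⟩

end IsBrownianBridge

theorem mainTheorem10 {Ω : Type*} [MeasurableSpace Ω] (P : Measure Ω) [IsProbabilityMeasure P]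
    (B : unitInterval → Ω → ℝ) (hB : IsBrownianBridge B P) (α : ℝ) (hα : 1 / 2 < α) :
    ∀ᵐ ω ∂P, ¬ ∃ x₀ : unitInterval,
      HolderRightAt α (fun t => B t ω) x₀ ∨ HolderLeftAt α (fun t => B t ω) x₀ := by
  -- Lowering the exponent to at most `1` weakens the Hölder condition, since distances in the
  -- interval are at most `1`, and it meets the requirement `β ≤ 1`.
  have hβ : 1 / 2 < min α 1 := lt_min hα (by norm_num)
  filter_upwards [hB.ae_not_exists_bound hβ (min_le_right _ _),
    hB.comp_symm.ae_not_exists_bound hβ (min_le_right _ _)] with ω hright hleft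
  rintro ⟨x₀, h | h⟩
  · exact hright ⟨x₀, h.1, h.exists_bound (min_le_left _ _)⟩
  · obtain ⟨C, δ, hC, hδ, hf⟩ := h.exists_bound (min_le_left α 1)
    refine hleft ⟨unitInterval.symm x₀, ?_, C, δ, hC, hδ, fun y hy hyδ => ?_⟩
    · have h0 : (0 : ℝ) < x₀ := h.1
      change (unitInterval.symm x₀ : ℝ) < 1
      rw [unitInterval.coe_symm_eq]
      linarith
    · have hy' : (unitInterval.symm x₀ : ℝ) < y := hy
      rw [unitInterval.coe_symm_eq] at hy' hyδ
      have hd : (x₀ : ℝ) - unitInterval.symm y = y - unitInterval.symm x₀ := by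
        rw [unitInterval.coe_symm_eq, unitInterval.coe_symm_eq]
        ring
      have := hf (unitInterval.symm y)
        (by change (unitInterval.symm y : ℝ) < x₀; rw [unitInterval.coe_symm_eq]; linarith)
        (by rw [unitInterval.coe_symm_eq]; linarith)
      rw [hd] at this
      simpa only [unitInterval.symm_symm] using this
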